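/- Let $m\ge 2$ and $n$ be natural numbers and let $\mathcal A=[a_{i_1 i_2\cdots i_m}]$ be a real tensor of order $m$ and dimension $n$ ($a_{i_1\cdots i_m}\in\mathbb R$, $i_1,\dots,i_m\in\{1,\dots,n\}$). For $x\in\mathbb R^n$ let $\mathcal A x^{m-1}\in\mathbb R^n$ be the vector with components $$(\mathcal A x^{m-1})_i=\sum_{i_2,\dots,i_m=1}^n a_{i i_2\cdots i_m}x_{i_2}\cdots x_{i_m},\qquad 1\le i\le n.$$ For $q\in\mathbb R^n$, the tensor complementarity problem $\mathrm{TCP}(\mathcal A,q)$ is to find $x\in\mathbb R^n$ with $x\ge 0$, $\mathcal A x^{m-1}+q\ge 0$ and $\langle x,\mathcal A x^{m-1}+q\rangle=0$ (vector inequalities are componentwise). $\mathcal A$ is called a $Q$-tensor if $\mathrm{TCP}(\mathcal A,q)$ has a solution for every $q\in\mathbb R^n$. Suppose that at least one of the following conditions holds: (i) there is a vector $d\in\mathbb R^n$ with $d>0$ (all components positive) such that the zero vector is the only solution of $\mathrm{TCP}(\mathcal A,0)$ and the only solution of $\mathrm{TCP}(\mathcal A,d)$; (ii) $\mathcal A$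 is strictly semi-positive: for every nonzero $x\ge 0$, $\max_{1\le i\le n} x_i(\mathcal A x^{m-1})_i>0$; (iii) $\mathcal A$ is strictly copositive: for every nonzero $x\ge 0$, $\langle\mathcal A x^{m-1},x\rangle>0$; (iv) $\mathcal A$ is positive definite: for every nonzero $x\in\mathbb R^n$, $\langle\mathcal A x^{m-1},x\rangle>0$. Then $\mathcal A$ is a $Q$-tensor, and for every $q\in\mathbb R^n$ the set of solutions of $\mathrm{TCP}(\mathcal A,q)$ is nonempty and compact. -/

import Mathlib

/-- Real tensors of order `m` and dimension `n`: families `a (i₁, …, iₘ)` of real entries. -/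
abbrev RealTensor (m n : ℕ) : Type := (Fin m → Fin n) → ℝ

namespace RealTensor

/-- For a tensor `A` of order `m = k + 1`, the map `F(x) = A x^(m-1)` on `ℝⁿ`, whose `i`-th
component is `∑ a (i, i₂, …, iₘ) x_{i₂} ⋯ x_{iₘ}`, the sum running over all `i₂, …, iₘ`. -/
noncomputable def map {k n : ℕ} (A : RealTensor (k + 1) n) (x : EuclideanSpace ℝ (Fin n)) :
    EuclideanSpace ℝ (Fin n) :=
  WithLp.toLp 2 fun i => ∑ j : Fin k → Fin n, A (Fin.cons i j) * ∏ l, x (j l)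

/-- The solution set of the tensor complementarity problem `TCP(A, q)`. -/
def tcpSolutions {k n : ℕ} (A : RealTensor (k + 1) n) (q : EuclideanSpace ℝ (Fin n)) :
    Set (EuclideanSpace ℝ (Fin n)) :=
  {x | (∀ i, 0 ≤ x i) ∧ (∀ i, 0 ≤ (A.map x + q) i) ∧ inner ℝ x (A.map x + q) = 0}

/-- `A` is a Q-tensor: `TCP(A, q)` has a solution for every `q`. -/
def IsQTensor {k n : ℕ} (A : RealTensor (k + 1) n) : Prop :=
  ∀ q : EuclideanSpace ℝ (Fin n), ∃ x, x ∈ A.tcpSolutions q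

/-- There is a (componentwise) positive vector `d` such that zero is the only solution of
`TCP(A, 0)` and the only solution of `TCP(A, d)`. -/
def KaramardianCondition {k n : ℕ} (A : RealTensor (k + 1) n) : Prop :=
  ∃ d : EuclideanSpace ℝ (Fin n), (∀ i, 0 < d i) ∧
    A.tcpSolutions 0 = {0} ∧ A.tcpSolutions d = {0}

/-- Strictly semi-positive (strictly semi-monotone): `max_i x_i (A x^(m-1))_i > 0` for all nonzero
`x ≥ 0`. The supremum is over a finite index set, nonempty because `x ≠ 0`, so it is a maximum. -/
def IsStrictlySemiPositive {k n : ℕ} (A : RealTensor (k + 1) n) : Prop :=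
  ∀ x : EuclideanSpace ℝ (Fin n), x ≠ 0 → (∀ i, 0 ≤ x i) → 0 < ⨆ i, x i * A.map x i

/-- Strictly copositive: `A x^m = ⟨A x^(m-1), x⟩ > 0` for all nonzero `x ≥ 0`. -/
def IsStrictlyCopositive {k n : ℕ} (A : RealTensor (k + 1) n) : Prop :=
  ∀ x : EuclideanSpace ℝ (Fin n), x ≠ 0 → (∀ i, 0 ≤ x i) → 0 < inner ℝ (A.map x) x

/-- Positive definite: `A x^m = ⟨A x^(m-1), x⟩ > 0` for all nonzero `x`. -/
def IsPosDef {k n : ℕ} (A : RealTensor (k + 1) n) : Prop :=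
  ∀ x : EuclideanSpace ℝ (Fin n), x ≠ 0 → 0 < inner ℝ (A.map x) x

end RealTensor

/-! Positive definite tensors are strictly copositive, these are strictly semi-positive, and these
satisfy the Karamardian condition with `d = (1, …, 1)`. So only that condition has to be treated.

Write `F` for `A.map`, which is homogeneous of degree `k ≥ 1`. The solutions of all problems with
data `q + μ d`, `μ ≥ 0`, are bounded (`exists_bound`): rescaling a large solution to `∑ d i * x i =
1` shrinks `q` towards `0`, and by compactness a nonzero solution for some datum `μ d` would remain.
A further rescaling makes that datum `0` or `d`, which is excluded (`eq_zero_of_ray`).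

For existence, the problem is truncated to `∑ d i * x i ≤ t`. A solution there solves the problem
for some `q + μ d`, where `μ = 0` unless the truncation is active (`exists_penalized_solution`). If
`t` exceeds the bound, it is inactive. The truncated problem needs a fixed-point type statement on
the simplex, `exists_mem_stdSimplex_forall_le`, obtained from Scarf's combinatorial lemma by
refining grids. -/

namespace Scarf

/-! ### Scarf's lemma: a parity argument on rooms and doors -/

variable {I Y : Type*}

/-- `S` is dominant for the rankings `r` if no point beats the minimum of `S` in every ranking. -/
def Dominant (r : I → Y → ℕ) (S : Finset Y) : Prop :=
  ∀ y, ∃ i, ∀ s ∈ S, r i y ≤ r i s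

theorem Dominant.mono {r : I → Y → ℕ} {S T : Finset Y} (h : Dominant r S) (hT : T ⊆ S) :
    Dominant r T := fun y => (h y).imp fun _ hi s hs => hi s (hT hs)

/-- `x` is the `r a`-largest point exceeding the minima `g j` in all rankings `j ≠ a`. -/
def IsReplacement (r : I → Y → ℕ) (g : I → Y) (a : I) (x : Y) : Prop :=
  (∀ j, j ≠ a → r j (g j) < r j x) ∧
    ∀ y, (∀ j, j ≠ a → r j (g j) < r j y) → r a y ≤ r a x

theorem exists_isReplacement [Fintype Y] {r : I → Y → ℕ} {g : I → Y} {a : I} {y : Y}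
    (hy : ∀ j, j ≠ a → r j (g j) < r j y) : ∃ x, IsReplacement r g a x := by
  classical
  obtain ⟨x, hx, hmax⟩ := Finset.exists_max_image
    (Finset.univ.filter fun y => ∀ j, j ≠ a → r j (g j) < r j y) (r a) ⟨y, by simpa using hy⟩
  simp only [Finset.mem_filter, Finset.mem_univ, true_and] at hx hmax
  exact ⟨x, hx, hmax⟩

section Door

variable {r : I → Y → ℕ} {T : Finset Y} {g : I → Y}

theorem Dominant.exists_min_eq (hr : ∀ i, Function.Injective (r i)) (hT : Dominant r T)
    (hgT : ∀ i, g i ∈ T) (hg : ∀ i, ∀ t ∈ T, r i (g i) ≤ r i t) {t : Y} (ht : t ∈ T) :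
    ∃ i, g i = t := by
  obtain ⟨i, hi⟩ := hT t
  exact ⟨i, hr i (le_antisymm (hg i t ht) (hi _ (hgT i)))⟩

/-- If `g` still covers `T` after `i` is deleted, then it is injective there by counting, so `i`
must belong to the colliding pair. -/
theorem exists_collision [Fintype I] [DecidableEq I]
    (hcard : T.card + 1 = Fintype.card I) (hgT : ∀ i, g i ∈ T) :
    ∃ a b, a ≠ b ∧ g a = g b ∧
      ∀ i, Set.SurjOn g ((Finset.univ.erase i : Finset I) : Set I) T → i = a ∨ i = b := by
  obtain ⟨a, -, b, -, hab, hgab⟩ := Finset.exists_ne_map_eq_of_card_lt_of_maps_to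
    (s := Finset.univ) (t := T) (by rw [Finset.card_univ]; omega) (f := g) (fun i _ => hgT i)
  refine ⟨a, b, hab, hgab, fun i hi => ?_⟩
  by_contra! h
  have hinj : Set.InjOn g ((Finset.univ.erase i : Finset I) : Set I) := by
    refine Finset.injOn_of_surjOn_of_card_le g (t := T) (fun j _ => hgT j) hi ?_
    rw [Finset.card_erase_of_mem (Finset.mem_univ _), Finset.card_univ]; omega
  exact hab (hinj (by simpa using h.1.symm) (by simpa using h.2.symm) hgab)

/-- In a dominant set every point is the minimum of some ranking. An added point takes over exactly
one ranking, and the old minima of the others must still cover `T`. So that ranking is `a` or `b`,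
and dominance makes the new point the largest one allowed. -/
theorem Dominant.insert_iff [Fintype I] [DecidableEq I] [DecidableEq Y]
    (hr : ∀ i, Function.Injective (r i)) (hT : Dominant r T)
    (hcard : T.card + 1 = Fintype.card I)
    (hgT : ∀ i, g i ∈ T) (hg : ∀ i, ∀ t ∈ T, r i (g i) ≤ r i t) {a b : I} (hab : a ≠ b)
    (hgab : g a = g b)
    (hsurj : ∀ i, Set.SurjOn g ((Finset.univ.erase i : Finset I) : Set I) T → i = a ∨ i = b)
    (x : Y) :
    (x ∉ T ∧ Dominant r (insert x T)) ↔ IsReplacement r g a x ∨ IsReplacement r g b x := by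
  constructor
  · rintro ⟨hx, hdom⟩
    obtain ⟨i, hi⟩ := hT x
    have hS : Set.SurjOn g ((Finset.univ.erase i : Finset I) : Set I) T := by
      intro t ht
      obtain ⟨j, hj⟩ := hdom t
      have h1 : g j = t := hr j (le_antisymm (hg j t ht) (hj _ (by simp [hgT j])))
      refine ⟨j, ?_, h1⟩
      have h2 := hj x (by simp)
      simp only [Finset.coe_erase, Finset.coe_univ, Set.mem_sdiff, Set.mem_univ, true_and,
        Set.mem_singleton_iff]
      rintro rfl
      exact hx ((hr j (le_antisymm h2 (hi t ht))) ▸ ht)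
    have hlt : ∀ j, j ≠ i → r j (g j) < r j x := by
      by_contra! hcon
      obtain ⟨j, hji, hjx⟩ := hcon
      -- both `i` and `j` then see `x` at or below `T`, so `g` maps a set that is too small onto `T`
      have hS' : T ⊆ ((Finset.univ.erase i).erase j).image g := by
        intro t ht
        obtain ⟨l, hl⟩ := hdom t
        have h1 : g l = t := hr l (le_antisymm (hg l t ht) (hl _ (by simp [hgT l])))
        have h2 := hl x (by simp)
        refine Finset.mem_image.2 ⟨l, ?_, h1⟩
        simp only [Finset.mem_erase, Finset.mem_univ, and_true]
        constructor
        · rintro rfl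
          exact hx (hr l (le_antisymm h2 (hjx.trans (hg l t ht))) ▸ ht)
        · rintro rfl
          exact hx (hr l (le_antisymm h2 (hi t ht)) ▸ ht)
      have h3 := (Finset.card_le_card hS').trans Finset.card_image_le
      rw [Finset.card_erase_of_mem (by simp [hji]), Finset.card_erase_of_mem (by simp),
        Finset.card_univ] at h3
      have : 0 < T.card := Finset.card_pos.2 ⟨_, hgT a⟩
      omega
    have hrep : IsReplacement r g i x := by
      refine ⟨hlt, fun y hy => ?_⟩
      obtain ⟨j, hj⟩ := hdom y
      by_cases hji : j = i
      · subst hji; exact hj x (by simp)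
      · exact absurd (hj (g j) (by simp [hgT j])) (not_le.2 (hy j hji))
    rcases hsurj i hS with rfl | rfl
    · exact Or.inl hrep
    · exact Or.inr hrep
  · have key : ∀ a b : I, a ≠ b → g a = g b → IsReplacement r g a x →
        x ∉ T ∧ Dominant r (insert x T) := by
      rintro a b hab hgab ⟨h1, h2⟩
      constructor
      · intro hx
        obtain ⟨j, rfl⟩ := hT.exists_min_eq hr hgT hg hx
        by_cases hja : j = a
        · subst hja
          exact absurd (h1 b hab.symm) (by rw [hgab]; exact lt_irrefl _)
        · exact lt_irrefl _ (h1 j hja)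
      · intro y
        by_cases hy : ∀ j, j ≠ a → r j (g j) < r j y
        · refine ⟨a, fun s hs => ?_⟩
          rcases Finset.mem_insert.1 hs with rfl | hs
          · exact h2 y hy
          · refine (h2 y hy).trans ?_
            obtain ⟨i, hi⟩ := hT x
            by_cases hia : i = a
            · subst hia; exact hi s hs
            · exact absurd (hi _ (hgT i)) (not_le.2 (h1 i hia))
        · push Not at hy
          obtain ⟨j, hja, hj⟩ := hy
          refine ⟨j, fun s hs => ?_⟩
          rcases Finset.mem_insert.1 hs with rfl | hs
          · exact hj.trans (h1 j hja).le
          · exact hj.trans (hg j s hs)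
    rintro (h | h)
    · exact key a b hab hgab h
    · exact key b a hab.symm hgab.symm h

end Door

variable [Fintype I] [DecidableEq I] [Fintype Y] [DecidableEq Y] {r : I → Y → ℕ} {s : I → Y}

open Classical in
/-- A door containing a point that is not a slack opens into zero or two rooms. -/
theorem even_card_rooms (hr : ∀ i, Function.Injective (r i))
    (hs : ∀ i j y, j ≠ i → y ∉ Set.range s → r i y < r i (s j))
    {T : Finset Y} (hcard : T.card + 1 = Fintype.card I) {x₀ : Y} (hx₀ : x₀ ∈ T)
    (hx₀s : x₀ ∉ Set.range s) :
    Even (Finset.univ.filter fun x => x ∉ T ∧ Dominant r (insert x T)).card := by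
  by_cases hT : Dominant r T
  swap
  · rw [Finset.filter_false_of_mem]
    · simp
    · rintro x - ⟨-, hx⟩
      exact hT (hx.mono (Finset.subset_insert _ _))
  have hmin : ∀ i, ∃ t ∈ T, ∀ t' ∈ T, r i t ≤ r i t' := fun i =>
    Finset.exists_min_image T (r i) ⟨x₀, hx₀⟩
  choose g hgT hg using hmin
  obtain ⟨a, b, hab, hgab, hsurj⟩ := exists_collision hcard hgT
  -- The slack `s a` is a candidate: in every other ranking it lies above the non-slack `x₀`, hence
  -- above the minimum of `T`.
  have hex : ∀ a, ∃ x, IsReplacement r g a x := fun a =>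
    exists_isReplacement (y := s a) fun j hj =>
      (hg j x₀ hx₀).trans_lt (hs j a x₀ hj.symm hx₀s)
  obtain ⟨x, hx⟩ := hex a
  obtain ⟨y, hy⟩ := hex b
  have huniq : ∀ a x y, IsReplacement r g a x → IsReplacement r g a y → x = y :=
    fun a x y hx hy => hr a (le_antisymm (hy.2 x hx.1) (hx.2 y hy.1))
  have hxy : x ≠ y := by
    rintro rfl
    obtain ⟨i, hi⟩ := hT x
    have : r i (g i) < r i x := by
      by_cases hia : i = a
      · exact hy.1 i (by rw [hia]; exact hab)
      · exact hx.1 i hia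
    exact absurd (hi _ (hgT i)) (not_le.2 this)
  have : (Finset.univ.filter fun x => x ∉ T ∧ Dominant r (insert x T)) = {x, y} := by
    ext z
    rw [Finset.mem_filter, hT.insert_iff hr hcard hgT hg hab hgab hsurj]
    simp only [Finset.mem_univ, true_and, Finset.mem_insert, Finset.mem_singleton]
    constructor
    · rintro (h | h)
      · exact Or.inl (huniq a _ _ h hx)
      · exact Or.inr (huniq b _ _ h hy)
    · rintro (rfl | rfl)
      · exact Or.inl hx
      · exact Or.inr hy
  rw [this, Finset.card_pair hxy]
  exact even_two

open Classical in
/-- The door made of all slacks but one opens into exactly one room. -/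
theorem card_rooms_slack (hr : ∀ i, Function.Injective (r i)) (hsinj : Function.Injective s)
    (hmin : ∀ i y, r i (s i) ≤ r i y)
    (hs : ∀ i j y, j ≠ i → y ∉ Set.range s → r i y < r i (s j)) (b : I) :
    (Finset.univ.filter fun x => x ∉ (Finset.univ.erase b).image s ∧
      Dominant r (insert x ((Finset.univ.erase b).image s))).card = 1 := by
  set T := (Finset.univ.erase b).image s with hTdef
  have hmemT : ∀ y, y ∈ T ↔ ∃ i, i ≠ b ∧ s i = y := fun y => by simp [hTdef]
  have hbT : s b ∉ T := by
    rw [hmemT]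
    rintro ⟨i, hi, h⟩
    exact hi (hsinj h)
  obtain ⟨x, hx, hxmax⟩ := Finset.exists_max_image (Finset.univ.filter fun y => y ∉ T) (r b)
    ⟨s b, by simpa using hbT⟩
  simp only [Finset.mem_filter, Finset.mem_univ, true_and] at hx hxmax
  rw [Finset.card_eq_one]
  refine ⟨x, ?_⟩
  ext z
  simp only [Finset.mem_filter, Finset.mem_univ, true_and, Finset.mem_singleton]
  constructor
  · rintro ⟨hz, hdom⟩
    obtain ⟨i, hi⟩ := hdom x
    by_cases hib : i = b
    · subst hib
      exact hr i (le_antisymm (hxmax z hz) (hi z (by simp)))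
    · have hsi : s i ∈ T := (hmemT _).2 ⟨i, hib, rfl⟩
      exact absurd (hr i (le_antisymm (hmin i x) (hi _ (Finset.mem_insert_of_mem hsi))) ▸ hsi) hx
  · rintro rfl
    refine ⟨hx, fun y => ?_⟩
    by_cases hy : y ∈ T
    · obtain ⟨i, -, rfl⟩ := (hmemT y).1 hy
      exact ⟨i, fun t _ => hmin i t⟩
    · refine ⟨b, fun t ht => ?_⟩
      rcases Finset.mem_insert.1 ht with rfl | ht
      · exact hxmax y hy
      · obtain ⟨j, hj, rfl⟩ := (hmemT t).1 ht
        by_cases hys : y ∈ Set.range s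
        · obtain ⟨l, rfl⟩ := hys
          have : l = b := by
            by_contra hl
            exact hy ((hmemT _).2 ⟨l, hl, rfl⟩)
          subst this
          exact hmin l _
        · exact (hs b j y hj hys).le

/-- A room that misses some color has zero or two doors with all colors but `b`. -/
theorem even_card_doors {I Y : Type*} [Fintype I] [DecidableEq I] [DecidableEq Y] {c : Y → I} {S : Finset Y} (hcard : S.card = Fintype.card I)
    (hS : S.image c ≠ Finset.univ) (b : I) :
    Even (S.filter fun x => (S.erase x).image c = Finset.univ.erase b).card := by
  by_cases hQ : ∃ x ∈ S, (S.erase x).image c = Finset.univ.erase b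
  swap
  · push Not at hQ
    rw [Finset.filter_false_of_mem hQ]
    simp
  obtain ⟨x, hxS, hx⟩ := hQ
  -- All colors but `b` occur once each in the door, so `x` repeats the color of exactly one point
  -- `y`. Only `x` and `y` can be removed without losing a color.
  have hinj : Set.InjOn c (S.erase x : Finset Y) := by
    apply Finset.injOn_of_card_image_eq
    rw [hx, Finset.card_erase_of_mem (Finset.mem_univ _), Finset.card_erase_of_mem hxS, hcard,
      Finset.card_univ]
  have hins : S.image c = insert (c x) (Finset.univ.erase b) := by
    rw [← hx, ← Finset.image_insert, Finset.insert_erase hxS]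
  have hcx : c x ≠ b := by
    intro h
    rw [h, Finset.insert_erase (Finset.mem_univ _)] at hins
    exact hS hins
  have hcx' : c x ∈ (S.erase x).image c := by rw [hx]; simpa using hcx
  obtain ⟨y, hy, hyx⟩ := Finset.mem_image.1 hcx'
  obtain ⟨hyx', hyS⟩ := Finset.mem_erase.1 hy
  have hpair : (S.filter fun x => (S.erase x).image c = Finset.univ.erase b) = {x, y} := by
    ext z
    simp only [Finset.mem_filter, Finset.mem_insert, Finset.mem_singleton]
    constructor
    · rintro ⟨hzS, hz⟩
      by_contra! hne
      have hzin : z ∈ S.erase x := Finset.mem_erase.2 ⟨hne.1, hzS⟩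
      have h1 : c z ∈ (S.erase z).image c := by
        rw [hz, ← hx]; exact Finset.mem_image_of_mem _ hzin
      obtain ⟨w, hw, hwz⟩ := Finset.mem_image.1 h1
      obtain ⟨hwz', hwS⟩ := Finset.mem_erase.1 hw
      by_cases hwx : w = x
      · subst hwx
        exact hne.2 (hinj hzin hy (by rw [hyx, hwz]))
      · exact hwz' (hinj (Finset.mem_coe.2 (Finset.mem_erase.2 ⟨hwx, hwS⟩)) hzin hwz)
    · rintro (rfl | rfl)
      · exact ⟨hxS, hx⟩
      · refine ⟨hyS, ?_⟩
        rw [← hx]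
        ext i
        simp only [Finset.mem_image, Finset.mem_erase]
        constructor
        · rintro ⟨w, ⟨hw1, hw2⟩, rfl⟩
          by_cases hwx : w = x
          · exact ⟨z, ⟨hyx', hyS⟩, by rw [hwx, hyx]⟩
          · exact ⟨w, ⟨hwx, hw2⟩, rfl⟩
        · rintro ⟨w, ⟨hw1, hw2⟩, rfl⟩
          by_cases hwy : w = z
          · exact ⟨x, ⟨hyx'.symm, hxS⟩, by rw [hwy, hyx]⟩
          · exact ⟨w, ⟨hwy, hw2⟩, rfl⟩
  rw [hpair, Finset.card_pair hyx'.symm]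
  exact even_two

/-- **Scarf's lemma**: given rankings with slack points, every coloring extending the tautological
coloring of the slacks has a dominant set containing all colors. -/
theorem exists_dominant_colorful [Nonempty I] (hr : ∀ i, Function.Injective (r i))
    (hsinj : Function.Injective s) (hmin : ∀ i y, r i (s i) ≤ r i y)
    (hs : ∀ i j y, j ≠ i → y ∉ Set.range s → r i y < r i (s j))
    (c : Y → I) (hc : ∀ i, c (s i) = i) :
    ∃ S : Finset Y, Dominant r S ∧ ∀ i, ∃ y ∈ S, c y = i := by
  classical
  by_contra! hcon
  obtain ⟨b⟩ := ‹Nonempty I›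
  set D : Finset (Finset Y) := Finset.univ.filter fun T =>
    T.card + 1 = Fintype.card I ∧ T.image c = Finset.univ.erase b with hD
  set R : Finset (Finset Y) := Finset.univ.filter fun S =>
    S.card = Fintype.card I ∧ Dominant r S with hR
  -- Incidences of doors and rooms are counted twice: the slack door contributes one and the other
  -- doors even numbers, while every room contributes an even number if none has all colors.
  have hcount : (D.sigma fun T => Finset.univ.filter fun x =>
        x ∉ T ∧ Dominant r (insert x T)).card =
      (R.sigma fun S => S.filter fun x => (S.erase x).image c = Finset.univ.erase b).card := by
    refine Finset.card_nbij' (fun p => ⟨insert p.2 p.1, p.2⟩) (fun p => ⟨p.1.erase p.2, p.2⟩)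
      ?_ ?_ ?_ ?_
    · rintro ⟨T, x⟩ h
      simp only [hD, hR, Finset.mem_coe, Finset.mem_sigma, Finset.mem_filter, Finset.mem_univ,
        true_and, Finset.mem_insert_self] at h ⊢
      obtain ⟨⟨h1, h2⟩, h3, h4⟩ := h
      exact ⟨⟨by rw [Finset.card_insert_of_notMem h3, h1], h4⟩, by
        rw [Finset.erase_insert h3, h2]⟩
    · rintro ⟨S, x⟩ h
      simp only [hD, hR, Finset.mem_coe, Finset.mem_sigma, Finset.mem_filter, Finset.mem_univ,
        true_and] at h ⊢
      obtain ⟨⟨h1, h2⟩, h3, h4⟩ := h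
      exact ⟨⟨by rw [Finset.card_erase_add_one h3, h1], h4⟩, by simp, by
        rwa [Finset.insert_erase h3]⟩
    · rintro ⟨T, x⟩ h
      simp only [hD, Finset.mem_coe, Finset.mem_sigma, Finset.mem_filter, Finset.mem_univ,
        true_and] at h
      simp [Finset.erase_insert h.2.1]
    · rintro ⟨S, x⟩ h
      simp only [hR, Finset.mem_coe, Finset.mem_sigma, Finset.mem_filter, Finset.mem_univ,
        true_and] at h
      simp [Finset.insert_erase h.2.1]
  rw [Finset.card_sigma, Finset.card_sigma] at hcount
  have hT₀ : (Finset.univ.erase b).image s ∈ D := by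
    simp only [hD, Finset.mem_filter, Finset.mem_univ, true_and]
    constructor
    · rw [Finset.card_image_of_injective _ hsinj, Finset.card_erase_add_one (Finset.mem_univ _),
        Finset.card_univ]
    · rw [Finset.image_image]
      have : c ∘ s = id := funext hc
      rw [this, Finset.image_id]
  rw [← Finset.add_sum_erase _ _ hT₀, card_rooms_slack hr hsinj hmin hs b] at hcount
  have h1 : Even (∑ S ∈ R, (S.filter fun x => (S.erase x).image c = Finset.univ.erase b).card) := by
    refine Finset.even_sum _ fun S hS => ?_
    simp only [hR, Finset.mem_filter, Finset.mem_univ, true_and] at hS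
    refine even_card_doors hS.1 (fun h => ?_) b
    obtain ⟨i, hi⟩ := hcon S hS.2
    obtain ⟨y, hy, hyi⟩ := Finset.mem_image.1 (h ▸ Finset.mem_univ i)
    exact hi y hy hyi
  rw [← hcount] at h1
  refine (Nat.not_even_iff_odd.2 (Odd.add_even odd_one ?_)) h1
  refine Finset.even_sum _ fun T hT => ?_
  simp only [hD, Finset.mem_erase, Finset.mem_filter, Finset.mem_univ, true_and] at hT
  obtain ⟨hne, hcard, himg⟩ := hT
  have : ∃ x₀ ∈ T, x₀ ∉ Set.range s := by
    by_contra! hall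
    apply hne
    apply Finset.eq_of_subset_of_card_le
    · intro y hy
      obtain ⟨i, rfl⟩ := hall y hy
      have : c (s i) ∈ T.image c := Finset.mem_image_of_mem _ hy
      rw [himg, hc] at this
      exact Finset.mem_image_of_mem _ this
    · rw [Finset.card_image_of_injective _ hsinj, Finset.card_erase_of_mem (Finset.mem_univ _),
        Finset.card_univ]
      omega
  obtain ⟨x₀, hx₀, hx₀s⟩ := this
  exact even_card_rooms hr hs hcard hx₀ hx₀s

end Scarf

/-! ### From grids to a continuous statement on the simplex -/

/-- For every coloring of the standard simplex and every mesh `1 / N` there is a point near which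
all colors occur, apart from colors whose coordinate is small there. -/
theorem exists_near_colorful {I : Type*} [Fintype I] [Nonempty I] (c : (I → ℝ) → I)
    {N : ℕ} (hN : 0 < N) :
    ∃ x ∈ stdSimplex ℝ I, ∀ i, x i ≤ Fintype.card I / N ∨
      ∃ p ∈ stdSimplex ℝ I, c p = i ∧ ∀ j, |p j - x j| ≤ Fintype.card I / N := by
  classical
  let X := {a : I → Fin (N + 1) // ∑ i, (a i : ℕ) = N}
  have hmk : ∀ y : I → ℕ, ∑ i, y i = N → ∃ a : X, ∀ i, (a.1 i : ℕ) = y i := fun y hy => by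
    have hle : ∀ i, y i < N + 1 := fun i => Nat.lt_succ_of_le
      (hy ▸ Finset.single_le_sum (f := y) (fun _ _ => Nat.zero_le _) (Finset.mem_univ i))
    exact ⟨⟨fun i => ⟨y i, hle i⟩, hy⟩, fun i => rfl⟩
  let M := Fintype.card X
  let e : X ≃ Fin M := Fintype.equivFin X
  let e' : I ≃ Fin (Fintype.card I) := Fintype.equivFin I
  let pt : X → I → ℝ := fun a i => ((a.1 i : ℕ) : ℝ) / N
  have hN' : (0 : ℝ) < N := by exact_mod_cast hN
  have hpt : ∀ a, pt a ∈ stdSimplex ℝ I := fun a => by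
    refine ⟨fun i => by positivity, ?_⟩
    simp only [pt]
    rw [← Finset.sum_div, ← Nat.cast_sum, a.2]
    exact div_self hN'.ne'
  -- Ranking `i` orders grid points by coordinate `i`, with ties broken by `e a < M`. Its own slack
  -- is at the bottom, the other slacks are above all grid points.
  let r : I → X ⊕ I → ℕ := fun i => Sum.elim (fun a => 1 + ((a.1 i : ℕ) * M + e a))
    fun j => if j = i then 0 else 1 + ((N + 1) * M + e' j)
  have hr_inl : ∀ i a, r i (Sum.inl a) = 1 + ((a.1 i : ℕ) * M + e a) := fun _ _ => rfl
  have hr_self : ∀ i, r i (Sum.inr i) = 0 := fun i => if_pos rfl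
  have hr_inr : ∀ i j, j ≠ i → r i (Sum.inr j) = 1 + ((N + 1) * M + e' j) := fun i j h => if_neg h
  have hmono : ∀ i (a b : X), r i (Sum.inl a) ≤ r i (Sum.inl b) → (a.1 i : ℕ) ≤ b.1 i := by
    intro i a b h
    rw [hr_inl, hr_inl] at h
    by_contra! hlt
    have h1 := Nat.mul_le_mul_right M (Nat.succ_le_of_lt hlt)
    have h2 := (e b).2
    rw [Nat.succ_mul] at h1
    omega
  have hlt_inr : ∀ i j a, j ≠ i → r i (Sum.inl a) < r i (Sum.inr j) := by
    intro i j a hj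
    rw [hr_inl, hr_inr i j hj]
    have h1 := Nat.mul_le_mul_right M (Nat.succ_le_of_lt (a.1 i).2)
    have h2 := (e a).2
    rw [Nat.succ_mul] at h1
    omega
  have hinj : ∀ i, Function.Injective (r i) := by
    rintro i (a | j) (b | l) h
    · have h1 := le_antisymm (hmono i a b h.le) (hmono i b a h.ge)
      rw [hr_inl, hr_inl, h1] at h
      have : e a = e b := Fin.ext (by omega)
      rw [e.injective this]
    · by_cases hl : l = i
      · subst hl; rw [hr_inl, hr_self] at h; omega
      · exact absurd h (hlt_inr i l a hl).ne
    · by_cases hj : j = i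
      · subst hj; rw [hr_inl, hr_self] at h; omega
      · exact absurd h (hlt_inr i j b hj).ne'
    · by_cases hj : j = i <;> by_cases hl : l = i
      · rw [hj, hl]
      · subst hj; rw [hr_self, hr_inr _ _ hl] at h; omega
      · subst hl; rw [hr_self, hr_inr _ _ hj] at h; omega
      · rw [hr_inr _ _ hj, hr_inr _ _ hl] at h
        have : e' j = e' l := Fin.ext (by omega)
        rw [e'.injective this]
  obtain ⟨S, hS, hcol⟩ := Scarf.exists_dominant_colorful (r := r) (s := Sum.inr) hinj
    Sum.inr_injective (fun i y => by rw [hr_self]; exact Nat.zero_le _)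
    (by
      rintro i j (a | l) hj hy
      · exact hlt_inr i j a hj
      · exact absurd ⟨l, rfl⟩ hy)
    (Sum.elim (fun a => c (pt a)) id) (fun i => rfl)
  -- dominance is only witnessed by rankings whose slack is missing from `S`
  have hdom : ∀ a : X, ∃ i, Sum.inr i ∉ S ∧ ∀ s ∈ S, r i (Sum.inl a) ≤ r i s := by
    intro a
    obtain ⟨i, hi⟩ := hS (Sum.inl a)
    refine ⟨i, fun h => ?_, hi⟩
    have := hi _ h
    rw [hr_self, hr_inl] at this
    omega
  have hcol' : ∀ i, Sum.inr i ∉ S → ∃ a : X, Sum.inl a ∈ S ∧ c (pt a) = i := by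
    intro i hi
    obtain ⟨a | j, hy, hyi⟩ := hcol i
    · exact ⟨a, hy, hyi⟩
    · obtain rfl : j = i := hyi
      exact absurd hy hi
  -- `m` collects the coordinatewise minima over `S`, where a slack in `S` counts as `0`.
  have hmin : ∃ m : I → ℕ, (∀ b : X, Sum.inl b ∈ S → ∀ i, m i ≤ b.1 i) ∧
      (∀ i, Sum.inr i ∈ S → m i = 0) ∧
      ∀ i, Sum.inr i ∉ S → ∃ a : X, Sum.inl a ∈ S ∧ (a.1 i : ℕ) = m i := by
    have : ∀ i, ∃ m : ℕ, (∀ b : X, Sum.inl b ∈ S → m ≤ b.1 i) ∧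
        (Sum.inr i ∈ S → m = 0) ∧
        (Sum.inr i ∉ S → ∃ a : X, Sum.inl a ∈ S ∧ (a.1 i : ℕ) = m) := by
      intro i
      by_cases hi : Sum.inr i ∈ S
      · exact ⟨0, fun _ _ => Nat.zero_le _, fun _ => rfl, fun h => absurd hi h⟩
      · obtain ⟨a₀, ha₀, -⟩ := hcol' i hi
        obtain ⟨a, ha, hmin⟩ := Finset.exists_min_image
          (Finset.univ.filter fun a : X => Sum.inl a ∈ S) (fun a => (a.1 i : ℕ))
          ⟨a₀, by simpa using ha₀⟩
        simp only [Finset.mem_filter, Finset.mem_univ, true_and] at ha hmin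
        exact ⟨a.1 i, hmin, fun h => absurd h hi, fun _ => ⟨a, ha, rfl⟩⟩
    choose m h1 h2 h3 using this
    exact ⟨m, fun b hb i => h1 i b hb, h2, h3⟩
  obtain ⟨m, hm, hm0, hm1⟩ := hmin
  -- Otherwise some grid point exceeds `m` in every coordinate, against dominance. Hence all grid
  -- points of `S` are within `Fintype.card I` steps of `m`.
  have hsum : N < ∑ i, m i + Fintype.card I := by
    by_contra! hle
    obtain ⟨i₁⟩ := ‹Nonempty I›
    obtain ⟨y, hy⟩ := hmk
      (fun i => m i + 1 + if i = i₁ then N - (∑ i, m i + Fintype.card I) else 0) (by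
        rw [Finset.sum_add_distrib, Finset.sum_add_distrib, Finset.sum_ite_eq']
        simp only [Finset.sum_const, Finset.card_univ, Finset.mem_univ, if_true, smul_eq_mul]
        omega)
    obtain ⟨i, hi, hyi⟩ := hdom y
    obtain ⟨a, ha, hai⟩ := hm1 i hi
    have h1 := hmono i y a (hyi _ ha)
    rw [hy, hai] at h1
    omega
  have hclose : ∀ b : X, Sum.inl b ∈ S → ∀ i, (b.1 i : ℕ) < m i + Fintype.card I := by
    intro b hb i
    have h1 : (b.1 i : ℕ) - m i ≤ ∑ j, ((b.1 j : ℕ) - m j) :=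
      Finset.single_le_sum (f := fun j => (b.1 j : ℕ) - m j) (fun _ _ => Nat.zero_le _)
        (Finset.mem_univ i)
    have h2 : ∑ j, ((b.1 j : ℕ) - m j) + ∑ j, m j = N := by
      rw [← Finset.sum_add_distrib]
      exact (Finset.sum_congr rfl fun j _ => Nat.sub_add_cancel (hm b hb j)).trans b.2
    omega
  obtain ⟨a₀, -⟩ : ∃ a : X, True := by
    obtain ⟨i₁⟩ := ‹Nonempty I›
    obtain ⟨a, -⟩ := hmk (fun i => if i = i₁ then N else 0) (by simp)
    exact ⟨a, trivial⟩
  obtain ⟨i, hi, -⟩ := hdom a₀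
  obtain ⟨x, hxS, -⟩ := hcol' i hi
  refine ⟨pt x, hpt x, fun i => ?_⟩
  by_cases hi : Sum.inr i ∈ S
  · left
    have h1 := hclose x hxS i
    rw [hm0 i hi, zero_add] at h1
    exact div_le_div_of_nonneg_right (by exact_mod_cast h1.le) hN'.le
  · right
    obtain ⟨a, haS, ha⟩ := hcol' i hi
    refine ⟨pt a, hpt a, ha, fun j => ?_⟩
    have h1 : ((a.1 j : ℕ) : ℝ) ≤ m j + Fintype.card I := by exact_mod_cast (hclose a haS j).le
    have h2 : ((x.1 j : ℕ) : ℝ) ≤ m j + Fintype.card I := by exact_mod_cast (hclose x hxS j).le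
    have h3 : (m j : ℝ) ≤ (a.1 j : ℕ) := by exact_mod_cast hm a haS j
    have h4 : (m j : ℝ) ≤ (x.1 j : ℕ) := by exact_mod_cast hm x hxS j
    simp only [pt]
    rw [← sub_div, abs_div, abs_of_pos hN']
    exact div_le_div_of_nonneg_right (abs_le.2 ⟨by linarith, by linarith⟩) hN'.le

open Filter Topology in
/-- A continuous map on the standard simplex has a point supported on its least components. -/
theorem exists_mem_stdSimplex_forall_le {I : Type*} [Fintype I] [Nonempty I]
    {G : (I → ℝ) → I → ℝ} (hG : Continuous G) :
    ∃ x ∈ stdSimplex ℝ I, ∀ i, 0 < x i → ∀ j, G x i ≤ G x j := by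
  -- Each point is colored by an index of a least component of `G`. Where `z i > 0`, points of color
  -- `i` accumulate at `z`, and the inequality passes to the limit.
  choose c hc using fun x : I → ℝ => Finite.exists_min (G x)
  choose x hx h using fun N : ℕ => exists_near_colorful c (Nat.succ_pos N)
  obtain ⟨z, hz, φ, hφ, hlim⟩ := (isCompact_stdSimplex ℝ I).tendsto_subseq hx
  refine ⟨z, hz, fun i hi j => ?_⟩
  have hε : Tendsto (fun n => (Fintype.card I : ℝ) / ((φ n).succ : ℕ)) atTop (𝓝 0) := by
    have h1 : Tendsto (fun n : ℕ => (Fintype.card I : ℝ) / (n.succ : ℕ)) atTop (𝓝 0) :=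
      (tendsto_const_div_atTop_nhds_zero_nat _).comp (tendsto_add_atTop_nat 1)
    exact h1.comp hφ.tendsto_atTop
  have hzi : Tendsto (fun n => x (φ n) i) atTop (𝓝 (z i)) := (tendsto_pi_nhds.1 hlim) i
  have hev : ∀ᶠ n in atTop, ∃ p : I → ℝ, c p = i ∧
      ∀ j, |p j - x (φ n) j| ≤ Fintype.card I / ((φ n).succ : ℕ) := by
    filter_upwards [hε.eventually_lt hzi hi] with n hn
    rcases h (φ n) i with h1 | ⟨p, -, hp⟩
    · exact absurd hn (not_lt.2 h1)
    · exact ⟨p, hp⟩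
  obtain ⟨p, hp⟩ := hev.choice
  have hplim : Tendsto p atTop (𝓝 z) := by
    refine tendsto_pi_nhds.2 fun l => ?_
    have h1 : Tendsto (fun n => p n l - x (φ n) l) atTop (𝓝 0) :=
      squeeze_zero_norm' (hp.mono fun n hn => by simpa using hn.2 l) hε
    simpa using h1.add ((tendsto_pi_nhds.1 hlim) l)
  have hGlim := (hG.tendsto z).comp hplim
  refine le_of_tendsto_of_tendsto (tendsto_pi_nhds.1 hGlim i) (tendsto_pi_nhds.1 hGlim j) ?_
  filter_upwards [hp] with n hn
  have := hc (p n) j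
  rwa [hn.1] at this

/-! ### Homogeneity and reduction to the Karamardian condition -/

namespace RealTensor

variable {k n : ℕ} {A : RealTensor (k + 1) n}

theorem map_apply (A : RealTensor (k + 1) n) (x : EuclideanSpace ℝ (Fin n)) (i : Fin n) :
    A.map x i = ∑ j : Fin k → Fin n, A (Fin.cons i j) * ∏ l, x (j l) := rfl

theorem map_smul_apply (A : RealTensor (k + 1) n) (c : ℝ) (x : EuclideanSpace ℝ (Fin n))
    (i : Fin n) : A.map (c • x) i = c ^ k * A.map x i := by
  simp only [map_apply, Finset.mul_sum, PiLp.smul_apply, smul_eq_mul, Finset.prod_mul_distrib,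
    Finset.prod_const, Finset.card_univ, Fintype.card_fin]
  exact Finset.sum_congr rfl fun j _ => by ring

theorem continuous_map_apply (A : RealTensor (k + 1) n) (i : Fin n) :
    Continuous fun x => A.map x i := by
  simp only [map_apply]
  fun_prop

theorem mem_tcpSolutions {q x : EuclideanSpace ℝ (Fin n)} :
    x ∈ A.tcpSolutions q ↔ (∀ i, 0 ≤ x i) ∧ (∀ i, 0 ≤ A.map x i + q i) ∧
      ∑ i, x i * (A.map x i + q i) = 0 := by
  simp only [tcpSolutions, Set.mem_ofPred_eq, PiLp.add_apply, PiLp.inner_apply,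
    RCLike.inner_apply, conj_trivial, mul_comm]

theorem inner_map_self (A : RealTensor (k + 1) n) (x : EuclideanSpace ℝ (Fin n)) :
    inner ℝ (A.map x) x = ∑ i, x i * A.map x i := by
  simp [PiLp.inner_apply]

theorem IsPosDef.isStrictlyCopositive (h : A.IsPosDef) : A.IsStrictlyCopositive :=
  fun x hx _ => h x hx

theorem IsStrictlyCopositive.isStrictlySemiPositive (h : A.IsStrictlyCopositive) :
    A.IsStrictlySemiPositive := fun x hx hx0 => by
  have h1 := h x hx hx0
  rw [inner_map_self] at h1
  obtain ⟨i, -, hi⟩ : ∃ i ∈ Finset.univ, 0 < x i * A.map x i := by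
    by_contra! hcon
    exact absurd h1 (not_lt.2 (Finset.sum_nonpos hcon))
  exact hi.trans_le (le_ciSup (f := fun i => x i * A.map x i) (Set.finite_range _).bddAbove i)

theorem zero_mem_tcpSolutions (hk : 1 ≤ k) (A : RealTensor (k + 1) n)
    {q : EuclideanSpace ℝ (Fin n)} (hq : ∀ i, 0 ≤ q i) : 0 ∈ A.tcpSolutions q := by
  have h0 : ∀ i, A.map 0 i = 0 := fun i => by
    have := map_smul_apply A 0 0 i
    rwa [smul_zero, zero_pow (by omega), zero_mul] at this
  rw [mem_tcpSolutions]
  simp [h0, hq]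

/-- Complementarity makes each `x i * (A.map x i + q i)` vanish, so with `q ≥ 0` no product `x i *
A.map x i` is positive. -/
theorem IsStrictlySemiPositive.tcpSolutions_eq (hk : 1 ≤ k) (h : A.IsStrictlySemiPositive)
    {q : EuclideanSpace ℝ (Fin n)} (hq : ∀ i, 0 ≤ q i) : A.tcpSolutions q = {0} := by
  refine Set.eq_singleton_iff_unique_mem.2 ⟨zero_mem_tcpSolutions hk A hq, fun x hx => ?_⟩
  rw [mem_tcpSolutions] at hx
  obtain ⟨hx0, hFx, hsum⟩ := hx
  by_contra hne
  have hpos := h x hne hx0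
  obtain ⟨i, hi⟩ : ∃ i, 0 < x i * A.map x i := by
    by_contra! hcon
    exact absurd hpos (not_lt.2 (Real.iSup_nonpos hcon))
  have h1 := (Finset.sum_eq_zero_iff_of_nonneg
    fun i _ => mul_nonneg (hx0 i) (hFx i)).1 hsum i (Finset.mem_univ i)
  rw [mul_add] at h1
  linarith [mul_nonneg (hx0 i) (hq i)]

theorem IsStrictlySemiPositive.karamardianCondition (hk : 1 ≤ k) (h : A.IsStrictlySemiPositive) :
    A.KaramardianCondition :=
  ⟨WithLp.toLp 2 fun _ => 1, fun _ => one_pos, h.tcpSolutions_eq hk fun _ => le_rfl,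
    h.tcpSolutions_eq hk fun _ => zero_le_one⟩

theorem isClosed_setOf_forall {ι E : Type*} [TopologicalSpace E] {p : ι → E → Prop}
    (h : ∀ i, IsClosed {x | p i x}) : IsClosed {x | ∀ i, p i x} := by
  rw [Set.ofPred_forall]
  exact isClosed_iInter h

theorem isCompact_box (b : Fin n → ℝ) :
    IsCompact {x : EuclideanSpace ℝ (Fin n) | ∀ i, 0 ≤ x i ∧ x i ≤ b i} := by
  have h := (isCompact_univ_pi fun i => isCompact_Icc (a := (0 : ℝ)) (b := b i)).image
    (PiLp.continuous_toLp 2 fun _ : Fin n => ℝ)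
  convert h
  ext x
  constructor
  · intro hx
    exact ⟨x.ofLp, fun i _ => hx i, rfl⟩
  · rintro ⟨y, hy, rfl⟩ i
    exact hy i (Set.mem_univ i)

theorem le_div_of_sum_mul_le {d x : EuclideanSpace ℝ (Fin n)} (hd : ∀ i, 0 < d i)
    (hx : ∀ i, 0 ≤ x i) {R : ℝ} (hR : ∑ i, d i * x i ≤ R) (i : Fin n) : x i ≤ R / d i := by
  rw [le_div_iff₀ (hd i), mul_comm]
  exact (Finset.single_le_sum (f := fun i => d i * x i)
    (fun j _ => mul_nonneg (hd j).le (hx j)) (Finset.mem_univ i)).trans hR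

/-! ### A priori bound along the ray `q + μ d` -/

/-- Under the uniqueness hypotheses, no nonzero `y ≥ 0` solves a problem with datum on the
ray spanned by `d`. -/
theorem eq_zero_of_ray (hk : 1 ≤ k) {d y : EuclideanSpace ℝ (Fin n)}
    (h0 : A.tcpSolutions 0 = {0}) (hd : A.tcpSolutions d = {0}) (hy : ∀ i, 0 ≤ y i)
    {μ : ℝ} (hμ : 0 ≤ μ) (hF : ∀ i, 0 ≤ A.map y i + μ * d i)
    (hsum : ∑ i, y i * (A.map y i + μ * d i) = 0) : y = 0 := by
  rcases hμ.eq_or_lt with rfl | hμ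
  · have : y ∈ A.tcpSolutions 0 := by
      rw [mem_tcpSolutions]
      simp only [zero_mul, PiLp.zero_apply] at hF hsum ⊢
      exact ⟨hy, hF, hsum⟩
    rwa [h0] at this
  -- Chosen so that `c ^ k = μ⁻¹`: scaling by `c` turns the datum `μ d` into `d`.
  · set c : ℝ := μ⁻¹ ^ ((k : ℝ)⁻¹) with hc
    have hcpos : 0 < c := Real.rpow_pos_of_pos (inv_pos.2 hμ) _
    have hck : c ^ k = μ⁻¹ := Real.rpow_inv_natCast_pow (inv_pos.2 hμ).le (by omega)
    have hFc : ∀ i, A.map (c • y) i + d i = μ⁻¹ * (A.map y i + μ * d i) := fun i => by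
      rw [map_smul_apply, hck, mul_add, inv_mul_cancel_left₀ hμ.ne']
    have : c • y ∈ A.tcpSolutions d := by
      rw [mem_tcpSolutions]
      refine ⟨fun i => mul_nonneg hcpos.le (hy i), fun i => ?_, ?_⟩
      · rw [hFc]
        exact mul_nonneg (inv_pos.2 hμ).le (hF i)
      · have : ∀ i, (c • y) i * (A.map (c • y) i + d i) =
            c * μ⁻¹ * (y i * (A.map y i + μ * d i)) := fun i => by
          rw [hFc, PiLp.smul_apply, smul_eq_mul]; ring
        simp only [this, ← Finset.mul_sum, hsum, mul_zero]
    rw [hd, Set.mem_singleton_iff, smul_eq_zero] at this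
    exact this.resolve_left hcpos.ne'

/-- The solutions of the problems with data `q + μ d`, `μ ≥ 0`, are uniformly bounded. -/
theorem exists_bound (hk : 1 ≤ k) {d : EuclideanSpace ℝ (Fin n)} (hdpos : ∀ i, 0 < d i)
    (h0 : A.tcpSolutions 0 = {0}) (hd : A.tcpSolutions d = {0})
    (q : EuclideanSpace ℝ (Fin n)) :
    ∃ R : ℝ, ∀ (x : EuclideanSpace ℝ (Fin n)) (μ : ℝ), 0 ≤ μ → (∀ i, 0 ≤ x i) →
      (∀ i, 0 ≤ A.map x i + q i + μ * d i) →
      ∑ i, x i * (A.map x i + q i + μ * d i) = 0 → ∑ i, d i * x i ≤ R := by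
  -- When `∑ d i * y i = 1`, complementarity for the datum `s q + μ d` forces this value of `μ`.
  -- Being continuous in `(y, s)`, it needs no separate bound in the compactness argument.
  let μ : EuclideanSpace ℝ (Fin n) × ℝ → ℝ := fun p =>
    -∑ i, p.1 i * (A.map p.1 i + p.2 * q i)
  have hF : ∀ i, Continuous fun p : EuclideanSpace ℝ (Fin n) × ℝ => A.map p.1 i := fun i =>
    (continuous_map_apply A i).comp continuous_fst
  have hμ : Continuous μ := by
    simp only [μ]
    fun_prop
  let Z : Set (EuclideanSpace ℝ (Fin n) × ℝ) := {p | (∀ i, 0 ≤ p.1 i) ∧ ∑ i, d i * p.1 i = 1 ∧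
    p.2 ∈ Set.Icc (0 : ℝ) 1 ∧ 0 ≤ μ p ∧ ∀ i, 0 ≤ A.map p.1 i + p.2 * q i + μ p * d i}
  have hZclosed : IsClosed Z := by
    refine IsClosed.and (isClosed_setOf_forall fun i => isClosed_le continuous_const (by fun_prop))
      (IsClosed.and (isClosed_eq (by fun_prop) continuous_const)
      (IsClosed.and (isClosed_Icc.preimage continuous_snd)
      (IsClosed.and (isClosed_le continuous_const hμ)
        (isClosed_setOf_forall fun i => isClosed_le continuous_const (by fun_prop)))))
  have hZ : IsCompact Z := by
    refine ((isCompact_box fun i => 1 / d i).prod (isCompact_Icc (a := (0 : ℝ)) (b := 1)))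
      |>.of_isClosed_subset hZclosed ?_
    rintro ⟨y, s⟩ ⟨h1, h2, h3, -⟩
    exact ⟨fun i => ⟨h1 i, le_div_of_sum_mul_le hdpos h1 h2.le i⟩, h3⟩
  have hpos : ∀ p ∈ Z, 0 < p.2 := by
    rintro ⟨y, s⟩ ⟨h1, h2, h3, h4, h5⟩
    refine lt_of_le_of_ne h3.1 ?_
    rintro (rfl : 0 = s)
    have h2' : ∑ i, d i * y i = 1 := h2
    have hsum : ∑ i, y i * (A.map y i + μ (y, 0) * d i) = 0 := by
      have e1 : ∀ i, y i * (A.map y i + μ (y, 0) * d i) =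
          y i * A.map y i + μ (y, 0) * (d i * y i) := fun i => by ring
      have e2 : μ (y, 0) = -∑ i, y i * A.map y i := by simp [μ]
      rw [Finset.sum_congr rfl fun i _ => e1 i, Finset.sum_add_distrib, ← Finset.mul_sum, h2', e2]
      ring
    have hy : y = 0 := eq_zero_of_ray hk h0 hd h1 h4 (fun i => by simpa using h5 i) hsum
    simp [hy] at h2'
  obtain ⟨ε, hε, hε1, hεZ⟩ : ∃ ε : ℝ, 0 < ε ∧ ε ≤ 1 ∧ ∀ p ∈ Z, ε ≤ p.2 := by
    rcases Z.eq_empty_or_nonempty with hZe | hZn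
    · exact ⟨1, one_pos, le_rfl, by simp [hZe]⟩
    · obtain ⟨p, hp, hmin⟩ := hZ.exists_isMinOn hZn continuous_snd.continuousOn
      exact ⟨p.2, hpos p hp, hp.2.2.1.2, fun p' hp' => hmin hp'⟩
  refine ⟨1 / ε, fun x lam hlam hx hFx hsum => ?_⟩
  by_contra! hlt
  set t := ∑ i, d i * x i with ht
  have ht1 : 1 < t := ((one_le_div hε).2 hε1).trans_lt hlt
  have ht0 : 0 < t := one_pos.trans ht1
  -- Dividing `x` by `t` multiplies `F` by `s`. Since `t > 1` and `k ≥ 1`, `s ≤ t⁻¹ < ε`, below the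
  -- minimum of `s` on `Z`.
  set s : ℝ := t⁻¹ ^ k with hs
  have hs0 : 0 < s := by positivity
  have hst : s ≤ t⁻¹ := pow_le_of_le_one (by positivity) (inv_le_one_of_one_le₀ ht1.le) (by omega)
  have hsε : s < ε := hst.trans_lt (by rwa [inv_lt_comm₀ ht0 hε, ← one_div])
  have hmap : ∀ i, A.map (t⁻¹ • x) i = s * A.map x i := map_smul_apply A _ x
  have hμs : μ (t⁻¹ • x, s) = s * lam := by
    have e1 : ∑ i, x i * (A.map x i + q i + lam * d i) =
        ∑ i, x i * (A.map x i + q i) + lam * t := by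
      rw [ht, Finset.mul_sum, ← Finset.sum_add_distrib]
      exact Finset.sum_congr rfl fun i _ => by ring
    have e2 : μ (t⁻¹ • x, s) = -(t⁻¹ * s * ∑ i, x i * (A.map x i + q i)) := by
      simp only [μ, hmap, PiLp.smul_apply, smul_eq_mul, Finset.mul_sum]
      congr 1
      exact Finset.sum_congr rfl fun i _ => by ring
    have e3 : ∑ i, x i * (A.map x i + q i) = -(lam * t) := by linarith
    rw [e2, e3]
    field_simp
  refine absurd (hεZ (t⁻¹ • x, s) ⟨fun i => mul_nonneg (by positivity) (hx i), ?_,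
    ⟨hs0.le, hsε.le.trans hε1⟩, ?_, fun i => ?_⟩) (not_le.2 hsε)
  · have : ∀ i, d i * (t⁻¹ • x) i = t⁻¹ * (d i * x i) := fun i => by
      rw [PiLp.smul_apply, smul_eq_mul]; ring
    simp only [this, ← Finset.mul_sum, ← ht]
    exact inv_mul_cancel₀ ht0.ne'
  · rw [hμs]; positivity
  · have := mul_nonneg hs0.le (hFx i)
    simp only [hμs, hmap]
    linarith

/-! ### Existence and compactness -/

/-- The problem `TCP(A, q)`, penalized by a multiple of `d` to stay in the region
`⟨d, x⟩ ≤ t`, has a solution. -/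
theorem exists_penalized_solution (A : RealTensor (k + 1) n) {d : EuclideanSpace ℝ (Fin n)}
    (hdpos : ∀ i, 0 < d i) (q : EuclideanSpace ℝ (Fin n)) {t : ℝ} (ht : 0 < t) :
    ∃ (x : EuclideanSpace ℝ (Fin n)) (μ : ℝ), 0 ≤ μ ∧ (∀ i, 0 ≤ x i) ∧
      (∀ i, 0 ≤ A.map x i + q i + μ * d i) ∧
      ∑ i, x i * (A.map x i + q i + μ * d i) = 0 ∧ (μ = 0 ∨ ∑ i, d i * x i = t) := by
  let X : (Option (Fin n) → ℝ) → EuclideanSpace ℝ (Fin n) := fun z =>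
    WithLp.toLp 2 fun i => t * z (some i) / d i
  have hX : Continuous X := by
    refine (PiLp.continuous_toLp 2 _).comp ?_
    fun_prop
  -- The vertex `none` carries the unused part of the budget `t`. Its component `0` makes the least
  -- value nonpositive, and that value is `-μ`; weight on `none` forces `μ = 0`.
  let G : (Option (Fin n) → ℝ) → Option (Fin n) → ℝ := fun z o =>
    o.elim 0 fun i => (A.map (X z) i + q i) / d i
  have hG : Continuous G := by
    refine continuous_pi fun o => ?_
    cases o with
    | none => exact continuous_const
    | some i =>
      exact (((continuous_map_apply A i).comp hX).add continuous_const).div_const _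
  obtain ⟨z, hz, hmin⟩ := exists_mem_stdSimplex_forall_le hG
  obtain ⟨o, ho⟩ : ∃ o, 0 < z o := by
    by_contra! hcon
    have := Finset.sum_nonpos fun o (_ : o ∈ Finset.univ) => hcon o
    rw [hz.2] at this
    linarith
  have hle : ∀ i, G z o ≤ (A.map (X z) i + q i) / d i := fun i => hmin o ho (some i)
  have hXnn : ∀ i, 0 ≤ X z i := fun i =>
    div_nonneg (mul_nonneg ht.le (hz.1 _)) (hdpos i).le
  refine ⟨X z, -G z o, neg_nonneg.2 (hmin o ho none), hXnn, fun i => ?_, ?_, ?_⟩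
  · have := (le_div_iff₀ (hdpos i)).1 (hle i)
    linarith
  · refine Finset.sum_eq_zero fun i _ => ?_
    rcases (hz.1 (some i)).eq_or_lt with h | h
    · have : X z i = t * z (some i) / d i := rfl
      rw [this, ← h]
      simp
    · have h1 : (A.map (X z) i + q i) / d i = G z o :=
        le_antisymm (hmin (some i) h o) (hle i)
      rw [div_eq_iff (hdpos i).ne'] at h1
      rw [h1]
      ring
  · rcases (hz.1 none).eq_or_lt with h | h
    · right
      have h1 := hz.2
      rw [Fintype.sum_option, ← h, zero_add] at h1
      have : ∀ i, d i * X z i = t * z (some i) := fun i => mul_div_cancel₀ _ (hdpos i).ne'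
      simp only [this, ← Finset.mul_sum, h1, mul_one]
    · left
      exact neg_eq_zero.2 (le_antisymm (hmin o ho none) (hmin none h o))

theorem isClosed_tcpSolutions (A : RealTensor (k + 1) n) (q : EuclideanSpace ℝ (Fin n)) :
    IsClosed (A.tcpSolutions q) := by
  have hF := continuous_map_apply A
  have : A.tcpSolutions q = {x | (∀ i, 0 ≤ x i) ∧ (∀ i, 0 ≤ A.map x i + q i) ∧
      ∑ i, x i * (A.map x i + q i) = 0} := Set.ext fun _ => mem_tcpSolutions
  rw [this]
  exact IsClosed.and (isClosed_setOf_forall fun i => isClosed_le continuous_const (by fun_prop))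
    (IsClosed.and (isClosed_setOf_forall fun i => isClosed_le continuous_const (by fun_prop))
      (isClosed_eq (by fun_prop) continuous_const))

/-- **Karamardian's theorem** for tensor complementarity problems. -/
theorem KaramardianCondition.nonempty_and_isCompact (hk : 1 ≤ k) (h : A.KaramardianCondition)
    (q : EuclideanSpace ℝ (Fin n)) :
    (A.tcpSolutions q).Nonempty ∧ IsCompact (A.tcpSolutions q) := by
  obtain ⟨d, hdpos, h0, hd⟩ := h
  obtain ⟨R, hR⟩ := exists_bound hk hdpos h0 hd q
  constructor
  · obtain ⟨x, μ, hμ, hx, hFx, hsum, h⟩ :=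
      exists_penalized_solution A hdpos q (t := max R 0 + 1) (by positivity)
    rcases h with rfl | h
    · simp only [zero_mul, add_zero] at hFx hsum
      exact ⟨x, mem_tcpSolutions.2 ⟨hx, hFx, hsum⟩⟩
    · have := hR x μ hμ hx hFx hsum
      linarith [le_max_left R 0]
  · refine (isCompact_box fun i => R / d i).of_isClosed_subset (isClosed_tcpSolutions A q) ?_
    intro x hx i
    obtain ⟨h1, h2, h3⟩ := mem_tcpSolutions.1 hx
    exact ⟨h1 i, le_div_of_sum_mul_le hdpos h1
      (hR x 0 le_rfl h1 (by simpa using h2) (by simpa using h3)) i⟩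

end RealTensor

theorem corollary3p2 {k n : ℕ} (hk : 1 ≤ k) (A : RealTensor (k + 1) n)
    (h : A.KaramardianCondition ∨ A.IsStrictlySemiPositive ∨ A.IsStrictlyCopositive ∨
      A.IsPosDef) :
    A.IsQTensor ∧
      ∀ q : EuclideanSpace ℝ (Fin n),
        (A.tcpSolutions q).Nonempty ∧ IsCompact (A.tcpSolutions q) := by
  have hK : A.KaramardianCondition := by
    rcases h with h | h | h | h
    · exact h
    · exact h.karamardianCondition hk
    · exact h.isStrictlySemiPositive.karamardianCondition hk
    · exact h.isStrictlyCopositive.isStrictlySemiPositive.karamardianCondition hk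
  exact ⟨fun q => (hK.nonempty_and_isCompact hk q).1, hK.nonempty_and_isCompact hk⟩
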